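/- Let $k$ be a field, let $G$ be a finite group, and let $S_n=\mathrm{Sym}(\{1,\dots,n\})$. For a group $\Gamma$ and a finite (left) $\Gamma$-set $Z$, let $k[Z]$ be the $k\Gamma$-module of all maps $f:Z\to k$, with action $(gf)(z)=f(g^{-1}z)$; two finite $\Gamma$-sets $Z,Z'$ are called linearly equivalent over $k$ if $k[Z]\cong k[Z']$ as $k\Gamma$-modules. Let $X$ and $Y$ be faithful $G$-sets with $n$ elements each. Choose any bijections $\sigma_X:X\to\{1,\dots,n\}$ and $\sigma_Y:Y\to\{1,\dots,n\}$, and let $\varphi_X,\varphi_Y:G\to S_n$ be the homomorphisms describing the actions through them: $\varphi_X(g)(i)=\sigma_X(g\,\sigma_X^{-1}(i))$, and similarly for $\varphi_Y$. If $X$ and $Y$ are linearly equivalent over $k$, then the $S_n$-sets of left cosets $S_n/\varphi_X(G)$ and $S_n/\varphi_Y(G)$ (with $S_n$ acting by left multiplication) are linearly equivalent over $k$. -/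

import Mathlib

/-- The permutation representation of `G` on `k[X]`, the `k`-module of all maps `X → k`:
`g` acts by precomposition, `(g • f) x = f (g⁻¹ • x)`. -/
def permRep (k G X : Type*) [CommRing k] [Group G] [MulAction G X] :
    Representation k G (X → k) where
  toFun g := LinearMap.funLeft k k (fun x : X => g⁻¹ • x)
  map_one' := by
    ext f x
    simp [LinearMap.funLeft]
  map_mul' g h := by
    ext f x
    simp [LinearMap.funLeft, mul_smul]

/-- The `G`-sets `X` and `Y` are linearly equivalent over `k` if `k[X]` and `k[Y]` are isomorphic
as modules over the group algebra `k[G]`. -/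
def LinearlyEquivalent (k G X Y : Type*) [CommRing k] [Group G] [MulAction G X]
    [MulAction G Y] : Prop :=
  Nonempty ((permRep k G X).asModule ≃ₗ[MonoidAlgebra k G] (permRep k G Y).asModule)

/-- The homomorphism `G → S_n` that describes the action of `G` on `X` after the points of `X`
have been numbered by `σ`. Here `S_n` is the group of permutations of `Fin n`. -/
def numberedActionHom (G : Type*) {X : Type*} [Group G] [MulAction G X] {n : ℕ}
    (σ : X ≃ Fin n) : G →* Equiv.Perm (Fin n) :=
  σ.permCongrHom.toMonoidHom.comp (MulAction.toPermHom G X)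

/-!
The point is to pass from `k[X] ≅ k[Y]` to an isomorphism of the permutation modules on the sets of
numberings, that is, of bijections `Fin n → X` and `Fin n → Y`. For every `m`, the group `G × S_m`
acts on the maps `Fin m → X`, through `G` on values and through `S_m` on places. The claim is that
`k[Inj(m, X)] ≅ k[Inj(m, Y)]` over `G × S_m`, where `Inj` denotes the injective maps
(`LinearlyEquivalent.injectiveMaps`); it is proved by strong induction on `m`.

* `k[X ^ m]` is the `m`-th tensor power of `k[X]`, so `k[X ^ m] ≅ k[Y ^ m]` over `G × S_m`
  (`LinearlyEquivalent.maps`).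
* A non-injective map `Fin m → X` is `i ∘ s` with `s : Fin m → Fin j` surjective, `i : Fin j → X`
  injective and `j < m`, uniquely up to `S_j`. Hence the isomorphisms for `j < m` assemble to one
  between the permutation modules on the non-injective maps
  (`linearlyEquivalent_injectiveMaps_compl`).
* `k[X ^ m]` is the direct sum of the permutation modules on the injective and on the non-injective
  maps, and modules of finite length cancel from direct sums (`nonempty_linearEquiv_of_prod`).

For `m = n` the injective maps are the bijections. Sending a bijection `i : Fin n → X` to the coset
of the inverse of the permutation `σ ∘ i` identifies the `S_n`-set of `G`-orbits of bijections with
the cosets of the image of `G` in `S_n`. Taking the `G`-invariant functions therefore turns the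
isomorphism for `m = n` into the one wanted (`LinearlyEquivalent.of_orbitMap`). The argument works
in every characteristic.
-/

/-! ### Cancellation of modules of finite length -/

universe u v w

/-- By Fitting's decomposition, an endomorphism of an indecomposable module of finite length is
invertible or nilpotent. -/
theorem isUnit_or_isUnit_one_sub_of_indecomposable {R A : Type*} [Ring R] [AddCommGroup A]
    [Module R A] [IsArtinian R A] [IsNoetherian R A]
    (h : ∀ p q : Submodule R A, IsCompl p q → p = ⊥ ∨ q = ⊥) (e : Module.End R A) :
    IsUnit e ∨ IsUnit (1 - e) := by
  obtain ⟨N, hN⟩ := Filter.eventually_atTop.mp e.eventually_isCompl_ker_pow_range_pow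
  have hc := hN (N + 1) (Nat.le_succ N)
  rcases h _ _ hc with hk | hr
  · left
    rw [Module.End.isUnit_iff]
    refine IsArtinian.bijective_of_injective_endomorphism e fun x y hxy => ?_
    apply LinearMap.ker_eq_bot.mp hk
    simp only [pow_succ, Module.End.mul_apply, hxy]
  · right
    exact IsNilpotent.isUnit_one_sub ⟨N + 1, LinearMap.range_eq_bot.mp hr⟩

/-- If the `A`-to-`A` entry of an isomorphism `A × B ≃ A × C` is invertible, then both `B` and `C` are
isomorphic to the kernel of its first component. -/
theorem nonempty_linearEquiv_of_isUnit_corner {R A B C : Type*} [Ring R] [AddCommGroup A]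
    [AddCommGroup B] [AddCommGroup C] [Module R A] [Module R B] [Module R C]
    (φ : (A × B) ≃ₗ[R] (A × C))
    (h : IsUnit ((LinearMap.fst R A C ∘ₗ φ.toLinearMap ∘ₗ LinearMap.inl R A B : A →ₗ[R] A) :
      Module.End R A)) :
    Nonempty (B ≃ₗ[R] C) := by
  rw [Module.End.isUnit_iff] at h
  let α : A ≃ₗ[R] A := LinearEquiv.ofBijective _ h
  let β : B →ₗ[R] A := LinearMap.fst R A C ∘ₗ φ.toLinearMap ∘ₗ LinearMap.inr R A B
  have hsplit : ∀ a b, (φ (a, b)).1 = α a + β b := by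
    intro a b
    have : ((a, b) : A × B) = (a, 0) + (0, b) := by simp
    rw [this, map_add]
    rfl
  let s : B →ₗ[R] A × B := (-(α.symm.toLinearMap ∘ₗ β)).prod LinearMap.id
  have hs : ∀ b, s b = (-(α.symm (β b)), b) := fun _ => rfl
  have hs0 : ∀ b, (φ (s b)).1 = 0 := by
    intro b
    rw [hs, hsplit]
    simp
  refine ⟨LinearEquiv.ofBijective (LinearMap.snd R A C ∘ₗ φ.toLinearMap ∘ₗ s) ⟨?_, ?_⟩⟩
  · rw [injective_iff_map_eq_zero]
    intro b hb
    have h0 : φ (s b) = 0 := Prod.ext (hs0 b) hb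
    have h1 : s b = 0 := by simpa using h0
    exact congrArg Prod.snd h1
  · intro c
    obtain ⟨⟨a, b⟩, hab⟩ := φ.surjective (0, c)
    refine ⟨b, ?_⟩
    have h1 : α a + β b = 0 := by rw [← hsplit, hab]
    have h2 : s b = (a, b) := by
      rw [hs, eq_neg_of_add_eq_zero_right h1]
      simp
    change (φ (s b)).2 = c
    rw [h2, hab]

theorem nonempty_linearEquiv_of_prod_of_indecomposable {R A B C : Type*} [Ring R]
    [AddCommGroup A] [AddCommGroup B] [AddCommGroup C] [Module R A] [Module R B] [Module R C]
    [IsArtinian R A] [IsNoetherian R A]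
    (h : ∀ p q : Submodule R A, IsCompl p q → p = ⊥ ∨ q = ⊥)
    (φ : (A × B) ≃ₗ[R] (A × C)) : Nonempty (B ≃ₗ[R] C) := by
  let α : A →ₗ[R] A := LinearMap.fst R A C ∘ₗ φ.toLinearMap ∘ₗ LinearMap.inl R A B
  let γ : A →ₗ[R] C := LinearMap.snd R A C ∘ₗ φ.toLinearMap ∘ₗ LinearMap.inl R A B
  let α' : A →ₗ[R] A := LinearMap.fst R A B ∘ₗ φ.symm.toLinearMap ∘ₗ LinearMap.inl R A C
  let β' : C →ₗ[R] A := LinearMap.fst R A B ∘ₗ φ.symm.toLinearMap ∘ₗ LinearMap.inr R A C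
  have hαγ : ∀ a, φ (a, 0) = (α a, γ a) := fun _ => rfl
  have hinv : ∀ a, α' (α a) + β' (γ a) = a := by
    intro a
    have h1 : φ.symm ((α a, 0) + (0, γ a)) = (a, 0) := by
      rw [← φ.symm_apply_apply (a, 0), hαγ]; simp
    rw [map_add] at h1
    exact congrArg Prod.fst h1
  -- The entries `α`, `γ` of `φ` and `α'`, `β'` of its inverse satisfy `α' α + β' γ = 1`, so one of
  -- the two summands is a unit. If it is `β' γ`, the shear `(a, c) ↦ (a + τ c, c)` of `A × C` with
  -- `τ = (1 - α) (β' γ)⁻¹ β'` changes the corner of `φ` from `α` to `α + τ γ = 1`.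
  rcases isUnit_or_isUnit_one_sub_of_indecomposable h (β' ∘ₗ γ) with hu | hu
  · obtain ⟨u, hu⟩ := hu
    let v : Module.End R A := ↑u⁻¹
    have hv : ∀ a, v (β' (γ a)) = a := fun a => by
      have := LinearMap.congr_fun u.inv_mul a
      rwa [hu] at this
    let τ : C →ₗ[R] A := (LinearMap.id - α) ∘ₗ v ∘ₗ β'
    let θ : (A × C) ≃ₗ[R] (A × C) := LinearEquiv.ofLinearMap
      ((LinearMap.fst R A C + τ ∘ₗ LinearMap.snd R A C).prod (LinearMap.snd R A C))
      ((LinearMap.fst R A C - τ ∘ₗ LinearMap.snd R A C).prod (LinearMap.snd R A C))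
      (by ext <;> simp) (by ext <;> simp)
    refine nonempty_linearEquiv_of_isUnit_corner (φ.trans θ) ?_
    convert isUnit_one
    ext a
    change α a + τ (γ a) = a
    change α a + (v (β' (γ a)) - α (v (β' (γ a)))) = a
    rw [hv]
    abel
  · refine nonempty_linearEquiv_of_isUnit_corner φ ?_
    rw [Module.End.isUnit_iff] at hu ⊢
    refine IsArtinian.bijective_of_injective_endomorphism α fun x y hxy => hu.1 ?_
    have : ∀ a, (1 - β' ∘ₗ γ : Module.End R A) a = α' (α a) := fun a => by
      conv_lhs => rw [LinearMap.sub_apply, Module.End.one_apply]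
      exact sub_eq_of_eq_add (hinv a).symm
    rw [this, this, hxy]

/-- Cancellation of a submodule `N` of `A`, by induction on `N`: a decomposable `N` is cancelled one
summand at a time. The induction moves a summand of `N` over to `B` and `C`, so these have to live
in a universe that contains that of `A`. -/
theorem nonempty_linearEquiv_of_submodule_prod {R : Type*} {A : Type u} [Ring R]
    [AddCommGroup A] [Module R A] [IsArtinian R A] [IsNoetherian R A] (N : Submodule R A) :
    ∀ {B C : Type (max u v)} [AddCommGroup B] [AddCommGroup C] [Module R B] [Module R C],
      ((N × B) ≃ₗ[R] (N × C)) → Nonempty (B ≃ₗ[R] C) := by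
  induction N using WellFoundedLT.induction with
  | _ N ih =>
    intro B C _ _ _ _ φ
    by_cases h : ∀ p q : Submodule R N, IsCompl p q → p = ⊥ ∨ q = ⊥
    · exact nonempty_linearEquiv_of_prod_of_indecomposable h φ
    push Not at h
    obtain ⟨p, q, hpq, hp, hq⟩ := h
    have hlt : ∀ r : Submodule R N, r ≠ ⊤ → r.map N.subtype < N := by
      intro r hr
      refine lt_of_le_of_ne (Submodule.map_subtype_le N r) fun heq => hr ?_
      apply Submodule.map_injective_of_injective N.injective_subtype
      rw [heq, Submodule.map_subtype_top]
    let ep := Submodule.equivMapOfInjective N.subtype N.injective_subtype p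
    let eq' := Submodule.equivMapOfInjective N.subtype N.injective_subtype q
    let e : N ≃ₗ[R] (p.map N.subtype × q.map N.subtype) :=
      (Submodule.prodEquivOfIsCompl p q hpq).symm.trans (ep.prodCongr eq')
    have hp' : p ≠ ⊤ := fun h => hq (by simpa [h] using hpq.disjoint)
    have hq' : q ≠ ⊤ := fun h => hp (by simpa [h] using hpq.disjoint)
    obtain ⟨ψ⟩ := ih _ (hlt p hp') (B := q.map N.subtype × B) (C := q.map N.subtype × C)
      ((LinearEquiv.prodAssoc R _ _ _).symm.trans
        ((e.symm.prodCongr (LinearEquiv.refl R B)).trans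
          (φ.trans ((e.prodCongr (LinearEquiv.refl R C)).trans (LinearEquiv.prodAssoc R _ _ _)))))
    exact ih _ (hlt q hq') ψ

/-- Modules of finite length cancel from direct sums. -/
theorem nonempty_linearEquiv_of_prod {R : Type*} {A : Type u} {B : Type v} {C : Type w} [Ring R]
    [AddCommGroup A] [AddCommGroup B] [AddCommGroup C] [Module R A] [Module R B] [Module R C]
    [IsArtinian R A] [IsNoetherian R A]
    (φ : (A × B) ≃ₗ[R] (A × C)) : Nonempty (B ≃ₗ[R] C) := by
  let t : (⊤ : Submodule R A) ≃ₗ[R] A := Submodule.topEquiv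
  let eB : ULift.{max u w} B ≃ₗ[R] B := ULift.moduleEquiv
  let eC : ULift.{max u v} C ≃ₗ[R] C := ULift.moduleEquiv
  obtain ⟨e⟩ := nonempty_linearEquiv_of_submodule_prod.{u, max v w} (⊤ : Submodule R A)
    ((t.prodCongr eB).trans (φ.trans (t.prodCongr eC).symm))
  exact ⟨eB.symm.trans (e.trans eC)⟩

/-! ### Linear equivalence of sets with a group action -/

theorem permRep_apply {k Γ Z : Type*} [CommRing k] [Group Γ] [MulAction Γ Z] (g : Γ) (f : Z → k)
    (z : Z) : permRep k Γ Z g f z = f (g⁻¹ • z) := rfl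

/-- Linear equivalence in terms of functions. As `g` runs over the whole group, equivariance may be
stated with `g` in place of `g⁻¹`. -/
theorem linearlyEquivalent_iff {k Γ Z Z' : Type*} [CommRing k] [Group Γ] [MulAction Γ Z]
    [MulAction Γ Z'] :
    LinearlyEquivalent k Γ Z Z' ↔ ∃ e : (Z → k) ≃ₗ[k] (Z' → k),
      ∀ (g : Γ) (f : Z → k) (z : Z'), e (fun x => f (g • x)) z = e f (g • z) := by
  constructor
  · rintro ⟨e⟩
    refine ⟨(permRep k Γ Z).asModuleEquiv.symm.trans
      ((e.restrictScalars k).trans (permRep k Γ Z').asModuleEquiv), fun g f z => ?_⟩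
    have h1 : ∀ v : (permRep k Γ Z).asModule, e (MonoidAlgebra.single g⁻¹ (1 : k) • v) =
      MonoidAlgebra.single g⁻¹ (1 : k) • e v := fun v => map_smul _ _ _
    have h2 := h1 ((permRep k Γ Z).asModuleEquiv.symm f)
    simp only [Representation.single_smul, one_smul] at h2
    have h3 := congrFun (congrArg (permRep k Γ Z').asModuleEquiv h2) z
    have h4 : permRep k Γ Z g⁻¹ f = fun x => f (g • x) := by
      ext x; rw [permRep_apply, inv_inv]
    rw [← h4]
    exact h3.trans (congrArg (fun γ : Γ => (permRep k Γ Z').asModuleEquiv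
      (e ((permRep k Γ Z).asModuleEquiv.symm f)) (γ • z)) (inv_inv g))
  · rintro ⟨e, he⟩
    let E : (permRep k Γ Z).asModule ≃ₗ[k] (permRep k Γ Z').asModule :=
      (permRep k Γ Z).asModuleEquiv.trans (e.trans (permRep k Γ Z').asModuleEquiv.symm)
    refine ⟨LinearEquiv.ofBijective
      (MonoidAlgebra.equivariantOfLinearOfComm E.toLinearMap fun g v => ?_) ?_⟩
    · simp only [Representation.single_smul, one_smul]
      exact funext fun z => he g⁻¹ v z
    · exact E.bijective

/-- Splitting a `Γ`-set into an invariant subset and its complement splits the permutation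
module. -/
theorem nonempty_linearEquiv_compl_prod (k : Type*) {Γ Z : Type*} [CommRing k] [Group Γ]
    [MulAction Γ Z] (P : SubMulAction Γ Z) :
    Nonempty ((permRep k Γ Z).asModule ≃ₗ[MonoidAlgebra k Γ]
      ((permRep k Γ (Pᶜ : SubMulAction Γ Z)).asModule × (permRep k Γ P).asModule)) := by
  classical
  let r : ∀ Q : SubMulAction Γ Z,
      (permRep k Γ Z).asModule →ₗ[MonoidAlgebra k Γ] (permRep k Γ Q).asModule := fun Q =>
    MonoidAlgebra.equivariantOfLinearOfComm
      ((permRep k Γ Q).asModuleEquiv.symm.toLinearMap ∘ₗ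
        LinearMap.funLeft k k (Subtype.val : Q → Z) ∘ₗ (permRep k Γ Z).asModuleEquiv.toLinearMap)
      fun g v => by
        simp only [Representation.single_smul, one_smul]
        rfl
  have hr : ∀ (Q : SubMulAction Γ Z) (f : Z → k) (z : Q), (r Q f : Q → k) z = f z :=
    fun _ _ _ => rfl
  refine ⟨LinearEquiv.ofBijective ((r Pᶜ).prod (r P)) ⟨fun f f' h => ?_, fun ⟨f₁, f₂⟩ => ?_⟩⟩
  · refine funext fun z => ?_
    by_cases hz : z ∈ P
    · exact congrFun (congrArg Prod.snd h : r P f = r P f') ⟨z, hz⟩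
    · exact congrFun (congrArg Prod.fst h : r Pᶜ f = r Pᶜ f') ⟨z, hz⟩
  · refine ⟨(fun z => if hz : z ∈ P then (f₂ : P → k) ⟨z, hz⟩
      else (f₁ : (Pᶜ : SubMulAction Γ Z) → k) ⟨z, hz⟩ : Z → k), Prod.ext ?_ ?_⟩
    · exact funext fun z => dif_neg z.2
    · exact funext fun z => dif_pos z.2

/-- Linearly equivalent invariant subsets may be removed: this is cancellation of permutation
modules. -/
theorem LinearlyEquivalent.of_compl {k Γ Z Z' : Type*} [Field k] [Group Γ] [MulAction Γ Z]
    [MulAction Γ Z'] [Finite Z] (P : SubMulAction Γ Z) (P' : SubMulAction Γ Z')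
    (h : LinearlyEquivalent k Γ Z Z')
    (hc : LinearlyEquivalent k Γ (Pᶜ : SubMulAction Γ Z) (P'ᶜ : SubMulAction Γ Z')) :
    LinearlyEquivalent k Γ P P' := by
  obtain ⟨e⟩ := h
  obtain ⟨ec⟩ := hc
  obtain ⟨s⟩ := nonempty_linearEquiv_compl_prod k P
  obtain ⟨s'⟩ := nonempty_linearEquiv_compl_prod k P'
  have : Finite (Pᶜ : SubMulAction Γ Z) := inferInstanceAs (Finite {z // z ∈ Pᶜ})
  have : IsArtinian (MonoidAlgebra k Γ) (permRep k Γ (Pᶜ : SubMulAction Γ Z)).asModule :=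
    isArtinian_of_tower k inferInstance
  have : IsNoetherian (MonoidAlgebra k Γ) (permRep k Γ (Pᶜ : SubMulAction Γ Z)).asModule :=
    isNoetherian_of_tower k inferInstance
  exact nonempty_linearEquiv_of_prod
    (s.symm.trans (e.trans (s'.trans (ec.symm.prodCongr (LinearEquiv.refl _ _)))))

/-- Passage to `Γ`-orbits: if `p : Z → Q` is the quotient of a `Γ × Δ`-set by `Γ`, then `k[Q]` is the
space of `Γ`-invariants of `k[Z]`, by composition with `p`, and likewise for `p' : Z' → Q'`. -/
theorem LinearlyEquivalent.of_orbitMap {k Γ Δ Z Z' Q Q' : Type*} [CommRing k] [Group Γ] [Group Δ]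
    [MulAction (Γ × Δ) Z] [MulAction (Γ × Δ) Z'] [MulAction Δ Q] [MulAction Δ Q']
    (p : Z → Q) (hp : Function.Surjective p) (hpΔ : ∀ (a : Γ × Δ) z, p (a • z) = a.2 • p z)
    (hpΓ : ∀ z₁ z₂, p z₁ = p z₂ → ∃ g : Γ, z₁ = (g, (1 : Δ)) • z₂)
    (p' : Z' → Q') (hp' : Function.Surjective p') (hpΔ' : ∀ (a : Γ × Δ) z, p' (a • z) = a.2 • p' z)
    (hpΓ' : ∀ z₁ z₂, p' z₁ = p' z₂ → ∃ g : Γ, z₁ = (g, (1 : Δ)) • z₂)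
    (h : LinearlyEquivalent k (Γ × Δ) Z Z') : LinearlyEquivalent k Δ Q Q' := by
  rw [linearlyEquivalent_iff] at h ⊢
  obtain ⟨e, he⟩ := h
  have he' : ∀ (a : Γ × Δ) (f : Z' → k) (z : Z),
      e.symm (fun x => f (a • x)) z = e.symm f (a • z) := by
    intro a f z
    have h1 : e (fun x => e.symm f (a • x)) = fun x => f (a • x) := by
      funext x
      rw [he, e.apply_symm_apply]
    rw [← h1, e.symm_apply_apply]
  have descend : ∀ (f : Q → k) (z : Z'),
      e (f ∘ p) (Function.surjInv hp' (p' z)) = e (f ∘ p) z := by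
    intro f z
    obtain ⟨g, hg⟩ := hpΓ' _ _ (Function.surjInv_eq hp' (p' z))
    rw [hg, ← he]
    refine congrFun (congrArg e (funext fun x => ?_)) z
    simp only [Function.comp_apply, hpΔ, one_smul]
  have descend' : ∀ (f : Q' → k) (z : Z),
      e.symm (f ∘ p') (Function.surjInv hp (p z)) = e.symm (f ∘ p') z := by
    intro f z
    obtain ⟨g, hg⟩ := hpΓ _ _ (Function.surjInv_eq hp (p z))
    rw [hg, ← he']
    refine congrFun (congrArg e.symm (funext fun x => ?_)) z
    simp only [Function.comp_apply, hpΔ', one_smul]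
  let F : (Q → k) →ₗ[k] (Q' → k) := LinearMap.funLeft k k (Function.surjInv hp') ∘ₗ
    e.toLinearMap ∘ₗ LinearMap.funLeft k k p
  let F' : (Q' → k) →ₗ[k] (Q → k) := LinearMap.funLeft k k (Function.surjInv hp) ∘ₗ
    e.symm.toLinearMap ∘ₗ LinearMap.funLeft k k p'
  have hF : ∀ f, F f ∘ p' = e (f ∘ p) := fun f => funext (descend f)
  have hF' : ∀ f, F' f ∘ p = e.symm (f ∘ p') := fun f => funext (descend' f)
  refine ⟨LinearEquiv.ofLinearMap F F' ?_ ?_, fun a f q => ?_⟩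
  · ext1 f
    apply hp'.injective_comp_right
    change F (F' f) ∘ p' = f ∘ p'
    rw [hF, hF', e.apply_symm_apply]
  · ext1 f
    apply hp.injective_comp_right
    change F' (F f) ∘ p = f ∘ p
    rw [hF', hF, e.symm_apply_apply]
  · obtain ⟨z, rfl⟩ := hp' q
    change (F (fun x => f (a • x)) ∘ p') z = F f (a • p' z)
    rw [hF]
    have h1 : a • p' z = p' (((1 : Γ), a) • z) := by rw [hpΔ']
    rw [h1]
    change _ = (F f ∘ p') _
    rw [hF, ← he]
    refine congrFun (congrArg e (funext fun x => ?_)) z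
    simp only [Function.comp_apply, hpΔ]

/-! ### Tensor powers of permutation modules -/

/-- The tensor power of a matrix with tensor factors indexed by `ι`; rows and columns are indexed by
maps from `ι`. -/
def Matrix.piPow {k X Y : Type*} [CommRing k] (ι : Type*) [Fintype ι] (A : Matrix Y X k) :
    Matrix (ι → Y) (ι → X) k :=
  Matrix.of fun y x => ∏ i, A (y i) (x i)

theorem Matrix.piPow_mul {k X Y Z : Type*} [CommRing k] [Fintype Y] [DecidableEq Y] (ι : Type*)
    [Fintype ι] [DecidableEq ι] (A : Matrix Z Y k) (B : Matrix Y X k) :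
    piPow ι (A * B) = piPow ι A * piPow ι B := by
  ext z x
  simp only [piPow, Matrix.of_apply, Matrix.mul_apply, Finset.prod_univ_sum,
    Fintype.piFinset_univ, Finset.prod_mul_distrib]

theorem Matrix.piPow_one {k X : Type*} [CommRing k] [DecidableEq X] (ι : Type*)
    [Fintype ι] : piPow ι (1 : Matrix X X k) = 1 := by
  classical
  ext y x
  simp only [piPow, Matrix.of_apply, Matrix.one_apply, Finset.prod_ite_zero, funext_iff,
    Finset.mem_univ, true_imp_iff, Finset.prod_const_one]

/-- `G` acts on maps `ι → X` through the values and `Perm ι` through the places. -/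
instance numberedMapsAction (G X ι : Type*) [Group G] [MulAction G X] :
    MulAction (G × Equiv.Perm ι) (ι → X) where
  smul a w := fun i => a.1 • w (a.2⁻¹ i)
  one_smul w := funext fun i => one_smul G (w i)
  mul_smul a b w := funext fun i => mul_smul a.1 b.1 (w (b.2⁻¹ (a.2⁻¹ i)))

theorem prodPerm_smul_apply {G X ι : Type*} [Group G] [MulAction G X] (a : G × Equiv.Perm ι)
    (w : ι → X) (i : ι) : (a • w) i = a.1 • w (a.2⁻¹ i) := rfl

theorem linearlyEquivalent_of_matrix {k Γ Z Z' : Type*} [CommRing k] [Group Γ] [MulAction Γ Z]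
    [MulAction Γ Z'] [Fintype Z] [Fintype Z'] [DecidableEq Z] [DecidableEq Z']
    (A : Matrix Z' Z k) (B : Matrix Z Z' k) (hAB : A * B = 1) (hBA : B * A = 1)
    (hA : ∀ (g : Γ) z' z, A (g • z') (g • z) = A z' z) : LinearlyEquivalent k Γ Z Z' := by
  rw [linearlyEquivalent_iff]
  refine ⟨Matrix.toLin'OfInv hBA hAB, fun g f z' => ?_⟩
  change (A.mulVec fun x => f (g • x)) z' = A.mulVec f (g • z')
  simp only [Matrix.mulVec, dotProduct]
  exact Fintype.sum_equiv (MulAction.toPerm g) _ _ fun z => by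
    rw [MulAction.toPerm_apply, hA]

theorem LinearlyEquivalent.maps {k G X Y : Type*} [CommRing k] [Group G] [MulAction G X]
    [MulAction G Y] [Finite X] [Finite Y] (ι : Type*) [Finite ι]
    (h : LinearlyEquivalent k G X Y) :
    LinearlyEquivalent k (G × Equiv.Perm ι) (ι → X) (ι → Y) := by
  classical
  have := Fintype.ofFinite X
  have := Fintype.ofFinite Y
  have := Fintype.ofFinite ι
  rw [linearlyEquivalent_iff] at h
  obtain ⟨e, he⟩ := h
  let A : Matrix Y X k := LinearMap.toMatrix' e.toLinearMap
  let B : Matrix X Y k := LinearMap.toMatrix' e.symm.toLinearMap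
  have hAB : A * B = 1 := by
    rw [← LinearMap.toMatrix'_comp, LinearEquiv.comp_symm, LinearMap.toMatrix'_id]
  have hBA : B * A = 1 := by
    rw [← LinearMap.toMatrix'_comp, LinearEquiv.symm_comp, LinearMap.toMatrix'_id]
  have hA : ∀ (g : G) y x, A (g • y) (g • x) = A y x := by
    intro g y x
    simp only [A, LinearMap.toMatrix'_apply]
    refine (he g _ y).symm.trans (congrFun (congrArg e (funext fun z => ?_)) y)
    simp [Pi.single_apply]
  refine linearlyEquivalent_of_matrix (A.piPow ι) (B.piPow ι) ?_ ?_ fun a y x => ?_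
  · rw [← Matrix.piPow_mul, hAB, Matrix.piPow_one]
  · rw [← Matrix.piPow_mul, hBA, Matrix.piPow_one]
  · simp only [Matrix.piPow, Matrix.of_apply, prodPerm_smul_apply, hA]
    exact Equiv.prod_comp (a.2⁻¹) fun i => A (y i) (x i)

/-! ### Injective and non-injective maps -/

/-- The injective maps `ι → X`, as an invariant subset of all maps. -/
def injectiveMaps (G X ι : Type*) [Group G] [MulAction G X] :
    SubMulAction (G × Equiv.Perm ι) (ι → X) where
  carrier := {w | Function.Injective w}
  smul_mem' a _ hw := (MulAction.injective a.1).comp (hw.comp (a.2⁻¹).injective)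

theorem comp_mem_injectiveMaps_compl {G X : Type*} [Group G] [MulAction G X] {m : ℕ} {j : Fin m}
    (i : Fin j → X) (s : Fin m → Fin j) :
    i ∘ s ∈ (injectiveMaps G X (Fin m))ᶜ := by
  intro h
  have := Fintype.card_le_of_injective s (Function.Injective.of_comp h)
  simp only [Fintype.card_fin] at this
  omega

/-- A non-injective map on `m` places factors through its image, which has fewer than `m` elements. -/
theorem exists_factorization {G X : Type*} [Group G] [MulAction G X] {m : ℕ}
    (w : ((injectiveMaps G X (Fin m))ᶜ : SubMulAction _ (Fin m → X))) :
    ∃ (j : Fin m) (i : injectiveMaps G X (Fin j)) (s : Fin m → Fin j),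
      Function.Surjective s ∧ w.1 = i.1 ∘ s := by
  classical
  have hw : ¬ Function.Injective w.1 := w.2
  let S := Finset.univ.image w.1
  have hS : S.card < m := by
    refine lt_of_le_of_ne (Finset.card_image_le.trans_eq (by simp)) fun h => hw ?_
    have hinj := Finset.card_image_iff.mp (h.trans (Finset.card_fin m).symm)
    exact fun x y hxy => hinj (Finset.mem_coe.mpr (Finset.mem_univ x))
      (Finset.mem_coe.mpr (Finset.mem_univ y)) hxy
  let e := S.equivFin
  have hmem : ∀ x, w.1 x ∈ S := fun x => Finset.mem_image_of_mem _ (Finset.mem_univ x)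
  refine ⟨⟨S.card, hS⟩, ⟨fun x => (e.symm x).1,
    Subtype.val_injective.comp e.symm.injective⟩, fun x => e ⟨w.1 x, hmem x⟩, fun y => ?_, ?_⟩
  · obtain ⟨x, -, hx⟩ := Finset.mem_image.mp (e.symm y).2
    exact ⟨x, e.eq_symm_apply.mp (Subtype.ext hx)⟩
  · funext x
    simp

/-- The map from functions on non-injective maps `Fin m → X` to functions on non-injective maps
`Fin m → Y` that is induced by linear maps `ψ j` between the functions on injective maps from
`Fin j`: the value of the image of `F` at `i ∘ s` is that of `ψ j (x ↦ F (x ∘ s))` at `i`, for a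
chosen factorization `i ∘ s`. -/
noncomputable def extendAlong {k G X Y : Type*} [CommRing k] [Group G] [MulAction G X]
    [MulAction G Y] {m : ℕ}
    (ψ : ∀ j : Fin m, (injectiveMaps G X (Fin j) → k) →ₗ[k] (injectiveMaps G Y (Fin j) → k)) :
    (((injectiveMaps G X (Fin m))ᶜ : SubMulAction _ (Fin m → X)) → k) →ₗ[k]
      (((injectiveMaps G Y (Fin m))ᶜ : SubMulAction _ (Fin m → Y)) → k) :=
  LinearMap.pi fun w =>
    let c := (exists_factorization w).choose_spec
    LinearMap.proj c.choose ∘ₗ ψ (exists_factorization w).choose ∘ₗ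
      LinearMap.funLeft k k fun i : injectiveMaps G X (Fin (exists_factorization w).choose) =>
        ⟨i.1 ∘ c.choose_spec.choose, comp_mem_injectiveMaps_compl _ _⟩

/-- The choice of a factorization does not matter: two factorizations of the same map differ by a
permutation of `Fin j`, and `ψ j` is equivariant. -/
theorem eval_eq_of_comp_eq {k G X Y : Type*} [CommRing k] [Group G] [MulAction G X]
    [MulAction G Y] {m : ℕ}
    (ψ : ∀ j : Fin m, (injectiveMaps G X (Fin j) → k) →ₗ[k] (injectiveMaps G Y (Fin j) → k))
    (hψ : ∀ (j : Fin m) (a : G × Equiv.Perm (Fin j)) f z, ψ j (fun x => f (a • x)) z = ψ j f (a • z))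
    (F : ((injectiveMaps G X (Fin m))ᶜ : SubMulAction _ (Fin m → X)) → k) {j j' : Fin m}
    (i : injectiveMaps G Y (Fin j)) (i' : injectiveMaps G Y (Fin j'))
    (s : Fin m → Fin j) (s' : Fin m → Fin j') (hs : Function.Surjective s)
    (hs' : Function.Surjective s') (h : i.1 ∘ s = i'.1 ∘ s') :
    ψ j (fun x => F ⟨x.1 ∘ s, comp_mem_injectiveMaps_compl _ _⟩) i =
      ψ j' (fun x => F ⟨x.1 ∘ s', comp_mem_injectiveMaps_compl _ _⟩) i' := by
  have hrange : Set.range i.1 = Set.range i'.1 := by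
    rw [← hs.range_comp, h, hs'.range_comp]
  have hj : j = j' := by
    have := congrArg Nat.card (congrArg Set.Elem hrange)
    rw [Nat.card_range_of_injective i.2, Nat.card_range_of_injective i'.2] at this
    simpa [Fin.ext_iff] using this
  subst hj
  let σ : Equiv.Perm (Fin j) := (Equiv.ofInjective i.1 i.2).trans
    ((Equiv.setCongr hrange).trans (Equiv.ofInjective i'.1 i'.2).symm)
  have hσ : ∀ x, i'.1 (σ x) = i.1 x := fun x =>
    Equiv.apply_ofInjective_symm i'.2 ⟨i.1 x, _⟩
  have hs_eq : s' = σ ∘ s := by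
    funext x
    apply i'.2
    exact (congrFun h x).symm.trans (hσ (s x)).symm
  have hi : i = ((1 : G), σ⁻¹) • i' := by
    refine Subtype.ext (funext fun x => ?_)
    change i.1 x = (1 : G) • i'.1 ((σ⁻¹)⁻¹ x)
    rw [one_smul, inv_inv, hσ]
  rw [hi, ← hψ]
  refine congrFun (congrArg (ψ j) (funext fun x => ?_)) i'
  refine congrArg F (Subtype.ext (funext fun t => ?_))
  change (1 : G) • x.1 ((σ⁻¹)⁻¹ (s t)) = x.1 (s' t)
  rw [one_smul, inv_inv, hs_eq]
  rfl

theorem extendAlong_apply {k G X Y : Type*} [CommRing k] [Group G] [MulAction G X]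
    [MulAction G Y] {m : ℕ}
    (ψ : ∀ j : Fin m, (injectiveMaps G X (Fin j) → k) →ₗ[k] (injectiveMaps G Y (Fin j) → k))
    (hψ : ∀ (j : Fin m) (a : G × Equiv.Perm (Fin j)) f z, ψ j (fun x => f (a • x)) z = ψ j f (a • z))
    (F : ((injectiveMaps G X (Fin m))ᶜ : SubMulAction _ (Fin m → X)) → k) {j : Fin m}
    (i : injectiveMaps G Y (Fin j)) (s : Fin m → Fin j) (hs : Function.Surjective s)
    (w : ((injectiveMaps G Y (Fin m))ᶜ : SubMulAction _ (Fin m → Y))) (hw : w.1 = i.1 ∘ s) :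
    extendAlong ψ F w = ψ j (fun x => F ⟨x.1 ∘ s, comp_mem_injectiveMaps_compl _ _⟩) i := by
  have c := (exists_factorization w).choose_spec.choose_spec.choose_spec
  exact eval_eq_of_comp_eq ψ hψ F _ i _ s c.1 hs (c.2.symm.trans hw)

theorem extendAlong_extendAlong {k G X Y : Type*} [CommRing k] [Group G] [MulAction G X]
    [MulAction G Y] {m : ℕ}
    (ψ : ∀ j : Fin m, (injectiveMaps G X (Fin j) → k) →ₗ[k] (injectiveMaps G Y (Fin j) → k))
    (ψ' : ∀ j : Fin m, (injectiveMaps G Y (Fin j) → k) →ₗ[k] (injectiveMaps G X (Fin j) → k))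
    (hψ : ∀ (j : Fin m) (a : G × Equiv.Perm (Fin j)) f z, ψ j (fun x => f (a • x)) z = ψ j f (a • z))
    (hψ' : ∀ (j : Fin m) (a : G × Equiv.Perm (Fin j)) f z, ψ' j (fun x => f (a • x)) z = ψ' j f (a • z))
    (hinv : ∀ j f, ψ' j (ψ j f) = f)
    (F : ((injectiveMaps G X (Fin m))ᶜ : SubMulAction _ (Fin m → X)) → k) :
    extendAlong ψ' (extendAlong ψ F) = F := by
  funext w
  obtain ⟨j, i, s, hs, hw⟩ := exists_factorization w
  rw [extendAlong_apply ψ' hψ' _ i s hs w hw]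
  have : (fun x : injectiveMaps G Y (Fin j) =>
      extendAlong ψ F ⟨x.1 ∘ s, comp_mem_injectiveMaps_compl _ _⟩) =
      ψ j fun x => F ⟨x.1 ∘ s, comp_mem_injectiveMaps_compl _ _⟩ :=
    funext fun x => extendAlong_apply ψ hψ F x s hs _ rfl
  rw [this, hinv]
  exact congrArg F (Subtype.ext hw.symm)

/-- The non-injective maps on `m` places are linearly equivalent once the injective maps on fewer than
`m` places are. -/
theorem linearlyEquivalent_injectiveMaps_compl {k G X Y : Type*} [CommRing k] [Group G]
    [MulAction G X] [MulAction G Y] {m : ℕ}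
    (h : ∀ j : Fin m, LinearlyEquivalent k (G × Equiv.Perm (Fin j))
      (injectiveMaps G X (Fin j)) (injectiveMaps G Y (Fin j))) :
    LinearlyEquivalent k (G × Equiv.Perm (Fin m))
      ((injectiveMaps G X (Fin m))ᶜ : SubMulAction _ (Fin m → X))
      ((injectiveMaps G Y (Fin m))ᶜ : SubMulAction _ (Fin m → Y)) := by
  simp only [linearlyEquivalent_iff] at h ⊢
  choose e he using h
  have he' : ∀ (j : Fin m) (a : G × Equiv.Perm (Fin j)) f z,
      (e j).symm (fun x => f (a • x)) z = (e j).symm f (a • z) := by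
    intro j a f z
    have h1 : e j (fun x => (e j).symm f (a • x)) = fun x => f (a • x) := by
      funext x
      rw [he, (e j).apply_symm_apply]
    rw [← h1, (e j).symm_apply_apply]
  let ψ := fun j => (e j).toLinearMap
  let ψ' := fun j => (e j).symm.toLinearMap
  refine ⟨LinearEquiv.ofLinearMap (extendAlong ψ) (extendAlong ψ') ?_ ?_, fun a F w => ?_⟩
  · exact LinearMap.ext fun F => extendAlong_extendAlong ψ' ψ he' he
      (fun j f => (e j).apply_symm_apply f) F
  · exact LinearMap.ext fun F => extendAlong_extendAlong ψ ψ' he he'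
      (fun j f => (e j).symm_apply_apply f) F
  · obtain ⟨j, i, s, hs, hw⟩ := exists_factorization w
    change extendAlong ψ _ w = extendAlong ψ F (a • w)
    rw [extendAlong_apply ψ he _ i s hs w hw,
      extendAlong_apply ψ he F ((a.1, (1 : Equiv.Perm (Fin j))) • i) (s ∘ ⇑(a.2⁻¹))
        (hs.comp (a.2⁻¹).surjective) (a • w) ?_]
    · change e j _ i = e j _ (_ • i)
      rw [← he]
      refine congrFun (congrArg (e j) (funext fun x => ?_)) i
      exact congrArg F (Subtype.ext rfl)
    · change a • w.1 = _
      rw [hw]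
      rfl

/-- Linearly equivalent `G`-sets have linearly equivalent sets of injective maps on `m` places, even
with the permutations of the places taken into account. -/
theorem LinearlyEquivalent.injectiveMaps {k G X Y : Type*} [Field k] [Group G] [MulAction G X]
    [MulAction G Y] [Finite X] [Finite Y] (h : LinearlyEquivalent k G X Y) (m : ℕ) :
    LinearlyEquivalent k (G × Equiv.Perm (Fin m))
      (injectiveMaps G X (Fin m)) (injectiveMaps G Y (Fin m)) := by
  induction m using Nat.strong_induction_on with
  | _ m ih =>
    exact (h.maps (Fin m)).of_compl _ _
      (linearlyEquivalent_injectiveMaps_compl fun j => ih j j.2)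

/-! ### Bijective maps and cosets -/

/-- The permutation `σ ∘ i` of `Fin n`, for `i : Fin n → X` injective and hence bijective. -/
noncomputable def numbering {G X : Type*} [Group G] [MulAction G X] {n : ℕ} (σ : X ≃ Fin n)
    (i : injectiveMaps G X (Fin n)) : Equiv.Perm (Fin n) :=
  Equiv.ofBijective (σ ∘ i.1) (Finite.injective_iff_bijective.mp (σ.injective.comp i.2))

theorem numbering_smul {G X : Type*} [Group G] [MulAction G X] {n : ℕ} (σ : X ≃ Fin n)
    (a : G × Equiv.Perm (Fin n)) (i : injectiveMaps G X (Fin n)) :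
    numbering σ (a • i) = numberedActionHom G σ a.1 * numbering σ i * a.2⁻¹ := by
  ext x
  change (σ (a.1 • i.1 (a.2⁻¹ x)) : ℕ) = σ (a.1 • σ.symm (σ (i.1 (a.2⁻¹ x))))
  rw [σ.symm_apply_apply]

theorem numbering_injective {G X : Type*} [Group G] [MulAction G X] {n : ℕ} (σ : X ≃ Fin n) :
    Function.Injective (numbering (G := G) σ) := fun _ _ h =>
  Subtype.ext (funext fun x => σ.injective (Equiv.congr_fun h x))

/-- The coset of `(σ ∘ i)⁻¹`. The inverse makes the `S_n`-action on places correspond to left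
multiplication and the `G`-action on values to right multiplication by the image of `G`. -/
noncomputable def numberingCoset {G X : Type*} [Group G] [MulAction G X] {n : ℕ} (σ : X ≃ Fin n)
    (i : injectiveMaps G X (Fin n)) : Equiv.Perm (Fin n) ⧸ (numberedActionHom G σ).range :=
  ((numbering σ i)⁻¹ : Equiv.Perm (Fin n))

theorem numberingCoset_surjective {G X : Type*} [Group G] [MulAction G X] {n : ℕ}
    (σ : X ≃ Fin n) : Function.Surjective (numberingCoset (G := G) σ) := by
  intro q
  obtain ⟨s, rfl⟩ := QuotientGroup.mk_surjective q
  refine ⟨⟨fun x => σ.symm (s⁻¹ x), σ.symm.injective.comp (s⁻¹).injective⟩, ?_⟩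
  rw [numberingCoset]
  congr 1
  rw [inv_eq_iff_eq_inv]
  ext x
  exact congrArg Fin.val (σ.apply_symm_apply _)

theorem numberingCoset_smul {G X : Type*} [Group G] [MulAction G X] {n : ℕ} (σ : X ≃ Fin n)
    (a : G × Equiv.Perm (Fin n)) (i : injectiveMaps G X (Fin n)) :
    numberingCoset σ (a • i) = a.2 • numberingCoset σ i := by
  rw [numberingCoset, numberingCoset, MulAction.Quotient.smul_coe, QuotientGroup.eq,
    numbering_smul]
  exact ⟨a.1, by simp [mul_assoc]⟩

theorem exists_smul_eq_of_numberingCoset_eq {G X : Type*} [Group G] [MulAction G X] {n : ℕ}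
    (σ : X ≃ Fin n) (i₁ i₂ : injectiveMaps G X (Fin n))
    (h : numberingCoset σ i₁ = numberingCoset σ i₂) :
    ∃ g : G, i₁ = (g, (1 : Equiv.Perm (Fin n))) • i₂ := by
  rw [numberingCoset, numberingCoset, QuotientGroup.eq, inv_inv] at h
  obtain ⟨g, hg⟩ := h
  refine ⟨g, numbering_injective σ ?_⟩
  rw [numbering_smul, hg]
  simp

theorem theorem4p1 (k G X Y : Type*) [Field k] [Group G] [Finite G]
    [MulAction G X] [MulAction G Y] [FaithfulSMul G X] [FaithfulSMul G Y]
    (n : ℕ) (σX : X ≃ Fin n) (σY : Y ≃ Fin n)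
    (hXY : LinearlyEquivalent k G X Y) :
    LinearlyEquivalent k (Equiv.Perm (Fin n))
      (Equiv.Perm (Fin n) ⧸ (numberedActionHom G σX).range)
      (Equiv.Perm (Fin n) ⧸ (numberedActionHom G σY).range) := by
  have := Finite.of_equiv _ σX.symm
  have := Finite.of_equiv _ σY.symm
  exact (hXY.injectiveMaps n).of_orbitMap
    (numberingCoset σX) (numberingCoset_surjective σX) (numberingCoset_smul σX)
    (exists_smul_eq_of_numberingCoset_eq σX)
    (numberingCoset σY) (numberingCoset_surjective σY) (numberingCoset_smul σY)
    (exists_smul_eq_of_numberingCoset_eq σY)
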